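/- Let $\mathcal H$ be a reproducing kernel Hilbert space of complex-valued functions on a set $X$, with kernel $k$ (so $f(w)=\langle f,k(\cdot,w)\rangle$ for $f\in\mathcal H$). Let $\mathrm{Mult}(\mathcal H)=\{\varphi:X\to\mathbb C:\ \varphi f\in\mathcal H\text{ for all }f\in\mathcal H\}$ be its multiplier algebra, with the norm $\|\varphi\|=\|M_\varphi\|$, where $M_\varphi f=\varphi f$. Assume: - $\mathcal H$ is normalized: there is $x_0\in X$ with $k(x,x_0)=1$ for all $x\in X$. - $\mathcal H$ is a complete Pick space: for all $r,n\in\mathbb N$, $z_1,\dots,z_n\in X$ and $W_1,\dots,W_n\in M_r(\mathbb C)$ such that the block matrix $[k(z_i,z_j)(I-W_iW_j^*)]_{i,j=1}^n$ is positive semidefinite, there is $\Phi\in M_r(\mathrm{Mult}(\mathcal H))$ of norm at most $1$ as an operator on $\mathcal H^r$ with $\Phi(z_i)=W_i$ for all $i$. - $X$ is a compact topological space, every function in $\mathcal H$ is continuous on $X$, and $\mathcal H$ separates the points of $X$. - $X$ is a maximal domain for $\mathcal H$: every non-zero bounded linear functional $\rho$ on $\mathcal H$ satisfying $\rho(fg)=\rho(f)\rho(g)$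 whenever $f,g,fg\in\mathcal H$ is the evaluation at a point of $X$. Let $\mathcal M$ be the maximal ideal space of $\mathrm{Mult}(\mathcal H)$, that is, the set of its characters with the Gelfand topology. Then the following are equivalent. 1. $\mathrm{Mult}(\mathcal H)=\mathcal H$ as vector spaces (of functions on $X$). 2. The corona theorem holds for $\mathrm{Mult}(\mathcal H)$: the characters of evaluation at points of $X$ are dense in $\mathcal M$. 3. The maximal ideal space of $\mathrm{Mult}(\mathcal H)$ is $X$: sending $x\in X$ to the character of evaluation at $x$ is a homeomorphism of $X$ onto $\mathcal M$. 4. The one-function corona theorem holds for $\mathrm{Mult}(\mathcal H)$: if $\varphi\in\mathrm{Mult}(\mathcal H)$ and $\inf_{x\in X}|\varphi(x)|>0$, then $1/\varphi\in\mathrm{Mult}(\mathcal H)$. 5. If $\varphi\in\mathrm{Mult}(\mathcal H)$ has no zero on $X$, then $1/\varphi\in\mathrm{Mult}(\mathcal H)$. -/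

import Mathlib

noncomputable section

namespace PickSpace

section Multipliers

variable {X : Type*} (H : Type*) [NormedAddCommGroup H] [InnerProductSpace ℂ H]
  [RKHS ℂ H X ℂ]

/-- The multiplier algebra `Mult(H)` of a reproducing kernel Hilbert space `H` of complex valued
functions on `X`, as an algebra of functions: all `φ : X → ℂ` with `φ f ∈ H` for all `f ∈ H`. -/
def multiplierAlgebra : Subalgebra ℂ (X → ℂ) where
  carrier := {φ | ∀ f : H, ∃ g : H, (g : X → ℂ) = φ * f}
  mul_mem' := by
    intro φ ψ hφ hψ f
    obtain ⟨g, hg⟩ := hψ f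
    obtain ⟨h, hh⟩ := hφ g
    exact ⟨h, by rw [hh, hg, mul_assoc]⟩
  add_mem' := by
    intro φ ψ hφ hψ f
    obtain ⟨g, hg⟩ := hφ f
    obtain ⟨h, hh⟩ := hψ f
    exact ⟨g + h, by rw [RKHS.coe_add, hg, hh, add_mul]⟩
  algebraMap_mem' := by
    intro c f
    refine ⟨c • f, ?_⟩
    rw [RKHS.coe_smul]
    ext x
    simp [Algebra.algebraMap_eq_smul_one]

/-- The multiplier algebra as a type. It is kept apart from the coercion of `multiplierAlgebra H`
to a type since the latter carries the topology of pointwise convergence, whereas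
`Mult(H)` carries the topology of the multiplier norm. -/
def Mult : Type _ := multiplierAlgebra H

instance : CommRing (Mult H) := inferInstanceAs (CommRing (multiplierAlgebra H))

instance : Algebra ℂ (Mult H) := inferInstanceAs (Algebra ℂ (multiplierAlgebra H))

instance : FunLike (Mult H) X ℂ where
  coe φ := φ.1
  coe_injective := fun _ _ h => Subtype.ext h

variable {H}

theorem Mult.exists_mul (φ : Mult H) (f : H) : ∃ g : H, (g : X → ℂ) = φ * f := φ.2 f

/-- The linear multiplication operator `f ↦ φ f` on `H`. -/
def Mult.mulLinear (φ : Mult H) : H →ₗ[ℂ] H where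
  toFun f := (φ.exists_mul f).choose
  map_add' f g := by
    apply DFunLike.coe_injective
    refine (φ.exists_mul (f + g)).choose_spec.trans ?_
    rw [RKHS.coe_add, RKHS.coe_add, (φ.exists_mul f).choose_spec, (φ.exists_mul g).choose_spec,
      mul_add]
  map_smul' c f := by
    apply DFunLike.coe_injective
    refine (φ.exists_mul (c • f)).choose_spec.trans ?_
    rw [RingHom.id_apply, RKHS.coe_smul, RKHS.coe_smul, (φ.exists_mul f).choose_spec,
      mul_smul_comm]

theorem Mult.mulLinear_apply (φ : Mult H) (f : H) (x : X) : φ.mulLinear f x = φ x * f x :=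
  congrFun (φ.exists_mul f).choose_spec x

variable [CompleteSpace H]

theorem Mult.continuous_mulLinear (φ : Mult H) : Continuous φ.mulLinear := by
  apply LinearMap.continuous_of_seq_closed_graph
  intro u f g hu hφu
  apply DFunLike.coe_injective
  ext x
  have h1 := ((RKHS.continuous_eval (H := H) x).tendsto g).comp hφu
  have h2 := (((RKHS.continuous_eval (H := H) x).tendsto f).comp hu).const_mul (φ x)
  rw [φ.mulLinear_apply]
  refine tendsto_nhds_unique h1 (h2.congr fun n => ?_)
  simp [φ.mulLinear_apply]

variable (H) in
/-- The algebra homomorphism `φ ↦ M_φ` from `Mult(H)` to the bounded operators on `H`, where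
`M_φ f = φ f`; boundedness of `M_φ` comes from the closed graph theorem. -/
def mulOp : Mult H →ₐ[ℂ] (H →L[ℂ] H) where
  toFun φ := ⟨φ.mulLinear, φ.continuous_mulLinear⟩
  map_one' := by
    ext f x
    simpa using (Mult.mulLinear_apply (1 : Mult H) f x).trans (one_mul (f x))
  map_mul' φ ψ := by
    ext f x
    change (φ * ψ).mulLinear f x = φ.mulLinear (ψ.mulLinear f) x
    rw [Mult.mulLinear_apply, Mult.mulLinear_apply, Mult.mulLinear_apply, ← mul_assoc]
    rfl
  map_zero' := by
    ext f x
    simpa using (Mult.mulLinear_apply (0 : Mult H) f x).trans (zero_mul (f x))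
  map_add' φ ψ := by
    ext f x
    change (φ + ψ).mulLinear f x = (φ.mulLinear f + ψ.mulLinear f) x
    rw [RKHS.coe_add, Pi.add_apply, Mult.mulLinear_apply, Mult.mulLinear_apply,
      Mult.mulLinear_apply, ← add_mul]
    rfl
  commutes' c := by
    ext f x
    change (algebraMap ℂ (Mult H) c).mulLinear f x = (c • f) x
    rw [Mult.mulLinear_apply, RKHS.coe_smul]
    rfl

theorem mulOp_apply (φ : Mult H) (f : H) (x : X) : mulOp H φ f x = φ x * f x :=
  φ.mulLinear_apply f x

/-- The multiplier norm `‖φ‖ = ‖M_φ‖`. (In this generality a seminorm; it is a norm as soon as the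
kernel does not vanish on the diagonal, e.g. if the kernel is normalized.) -/
instance : SeminormedCommRing (Mult H) :=
  { SeminormedRing.induced (Mult H) (H →L[ℂ] H) (mulOp H) with
    mul_comm := mul_comm }

instance : NormedAlgebra ℂ (Mult H) where
  norm_smul_le c φ := by
    change ‖mulOp H (c • φ)‖ ≤ ‖c‖ * ‖mulOp H φ‖
    rw [map_smul]
    exact norm_smul_le _ _

theorem Mult.norm_eq (φ : Mult H) : ‖φ‖ = ‖mulOp H φ‖ := rfl

end Multipliers

section Spaces

variable {X : Type*} (H : Type*) [NormedAddCommGroup H] [InnerProductSpace ℂ H] [CompleteSpace H]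
  [RKHS ℂ H X ℂ]

/-- The scalar reproducing kernel `k(z, w)`, with `f(w) = ⟨f, k(·, w)⟩` for `f ∈ H`. -/
def ker (z w : X) : ℂ := RKHS.kernel H z w 1

/-- The kernel is normalized at some point `x₀`: `k(x, x₀) = 1` for all `x`. -/
def IsNormalized : Prop := ∃ x₀ : X, ∀ x : X, ker H x x₀ = 1

open scoped Matrix ComplexOrder in
/-- The complete Pick property: whenever `W₁, …, Wₙ` are `r × r` matrices and the block matrix
`[k(zᵢ, zⱼ) (I - Wᵢ Wⱼ*)]` is positive semidefinite, there is `Φ ∈ M_r(Mult(H))` with norm at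
most one as an operator on the Hilbert space direct sum of `r` copies of `H`, and
`Φ(zᵢ) = Wᵢ` for all `i`. -/
def IsCompletePick : Prop :=
  ∀ (r n : ℕ) (z : Fin n → X) (W : Fin n → Matrix (Fin r) (Fin r) ℂ),
    (Matrix.of fun p q : Fin n × Fin r =>
      ker H (z p.1) (z q.1) * (1 - W p.1 * (W q.1)ᴴ) p.2 q.2).PosSemidef →
    ∃ Φ : Matrix (Fin r) (Fin r) (Mult H),
      (∀ h : Fin r → H, ∑ i, ‖∑ j, mulOp H (Φ i j) (h j)‖ ^ 2 ≤ ∑ j, ‖h j‖ ^ 2) ∧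
      ∀ (i : Fin n) (a b : Fin r), Φ a b (z i) = W i a b

/-- A nonzero bounded functional `ρ` on `H` is partially multiplicative if
`ρ(f g) = ρ(f) ρ(g)` whenever `f`, `g` and `f g` belong to `H`. -/
def IsPartiallyMultiplicative (ρ : H →L[ℂ] ℂ) : Prop :=
  ρ ≠ 0 ∧ ∀ f g h : H, (h : X → ℂ) = f * g → ρ h = ρ f * ρ g

/-- `X` is a maximal domain for `H`: every partially multiplicative functional on `H` is the
evaluation at a point of `X`. -/
def IsMaximalDomain : Prop :=
  ∀ ρ : H →L[ℂ] ℂ, IsPartiallyMultiplicative H ρ → ∃ x : X, ∀ f : H, ρ f = f x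

/-- The maximal ideal space of `Mult(H)`: the characters (nonzero multiplicative continuous
linear functionals) of `Mult(H)` with the Gelfand (that is, the weak-*) topology. -/
abbrev MaxIdealSpace : Type _ := WeakDual.characterSpace ℂ (Mult H)

/-- The corona theorem holds for `Mult(H)`: the evaluations at points of `X` are dense in the
maximal ideal space of `Mult(H)`. -/
def CoronaTheorem : Prop :=
  Dense {χ : MaxIdealSpace H | ∃ x : X, ∀ φ : Mult H, χ φ = φ x}

/-- The one-function corona theorem holds for `Mult(H)`: if `φ ∈ Mult(H)` is bounded below
on `X`, then `1 / φ ∈ Mult(H)`. -/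
def OneFunctionCoronaTheorem : Prop :=
  ∀ φ ∈ multiplierAlgebra H, (∃ c : ℝ, 0 < c ∧ ∀ x : X, c ≤ ‖φ x‖) →
    (fun x => 1 / φ x) ∈ multiplierAlgebra H

end Spaces

end PickSpace

end

noncomputable section

open scoped ComplexOrder ComplexConjugate InnerProductSpace InnerProduct Matrix TensorProduct

/-!
Complete Pick interpolation shows that `1 - 1 / k` is positive semidefinite, so that it is
`⟨b(x), b(y)⟩` for a feature map `b`, and that the row of multipliers with values `⟨b(x), ·⟩` is
contractive. Hence `k(·, w)` is a multiplier for every `w`, and every `f ∈ H` of norm one is the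
quotient of the multipliers `f / u` and `1 / u`, where `u(z) = ⟨k(·, z) f, f⟩` has no zeros. If
reciprocals of zero-free multipliers are multipliers, this gives `H = Mult(H)`. If `H = Mult(H)`,
then every character of `Mult(H)` restricts to a partially multiplicative functional on `H`, hence
is a point evaluation by maximality of `X`. Density of the evaluations makes a multiplier bounded
below on `X` nonzero at every character, hence invertible, and compactness of `X` bounds a
zero-free multiplier below.
-/

namespace PickSpace

section PositiveMatrices

variable {ι E F : Type*} [SeminormedAddCommGroup E] [InnerProductSpace ℂ E]
  [SeminormedAddCommGroup F] [InnerProductSpace ℂ F]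

theorem ofReal_norm_sq (v : E) : ((‖v‖ ^ 2 : ℝ) : ℂ) = ⟪v, v⟫_ℂ := by
  rw [inner_self_eq_norm_sq_to_K (𝕜 := ℂ)]
  push_cast
  rfl

theorem finsuppSum_gram (v : ι → E) (s : ι →₀ ℂ) :
    (s.sum fun i a => s.sum fun j b => star a * Matrix.gram ℂ v i j * b) =
      ((‖Finsupp.linearCombination ℂ v s‖ ^ 2 : ℝ) : ℂ) := by
  rw [ofReal_norm_sq, Finsupp.linearCombination_apply, Finsupp.sum_inner]
  refine Finsupp.sum_congr fun i _ => ?_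
  rw [Finsupp.inner_sum]
  refine Finsupp.sum_congr fun j _ => ?_
  rw [Matrix.gram_apply, inner_smul_left, inner_smul_right, Complex.star_def]
  ring

theorem posSemidef_gram_sub_gram_iff {f : ι → E} {g : ι → F} :
    (Matrix.gram ℂ f - Matrix.gram ℂ g).PosSemidef ↔
      ∀ s : ι →₀ ℂ,
        ‖Finsupp.linearCombination ℂ g s‖ ≤ ‖Finsupp.linearCombination ℂ f s‖ := by
  have hquad (s : ι →₀ ℂ) :
      (s.sum fun i a => s.sum fun j b =>
        star a * (Matrix.gram ℂ f - Matrix.gram ℂ g) i j * b) =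
      ((‖Finsupp.linearCombination ℂ f s‖ ^ 2 -
        ‖Finsupp.linearCombination ℂ g s‖ ^ 2 : ℝ) : ℂ) := by
    rw [Complex.ofReal_sub, ← finsuppSum_gram, ← finsuppSum_gram]
    simp only [Matrix.sub_apply, mul_sub, sub_mul, Finsupp.sum_sub]
  refine (and_iff_right
    ((Matrix.isHermitian_gram ℂ f).sub (Matrix.isHermitian_gram ℂ g))).trans
    (forall_congr' fun s => ?_)
  rw [hquad, ← Complex.ofReal_zero, Complex.real_le_real, sub_nonneg,
    sq_le_sq₀ (norm_nonneg _) (norm_nonneg _)]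

theorem posSemidef_gram (v : ι → E) : (Matrix.gram ℂ v).PosSemidef := by
  have h : (Matrix.gram ℂ v - Matrix.gram ℂ (0 : ι → E)).PosSemidef :=
    posSemidef_gram_sub_gram_iff.2 fun s => by simp
  rwa [Matrix.gram_zero, sub_zero] at h

theorem posSemidef_of_apply_eq {M N : Matrix ι ι ℂ} (hN : N.PosSemidef)
    (h : ∀ i j, M i j = N i j) : M.PosSemidef :=
  Matrix.ext h ▸ hN

theorem posSemidef_of_submatrix_fin {M : Matrix ι ι ℂ}
    (h : ∀ (n : ℕ) (z : Fin n → ι), (M.submatrix z z).PosSemidef) : M.PosSemidef := by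
  refine ⟨?_, fun s => ?_⟩
  · ext i j
    exact (h 2 ![i, j]).1.apply 0 1
  · let z : Fin s.support.card → ι := fun p => s.support.equivFin.symm p
    convert (h _ z).dotProduct_mulVec_nonneg (s ∘ z) using 1
    simp only [Finsupp.sum, dotProduct, Matrix.mulVec, Matrix.submatrix_apply, Pi.star_apply,
      Function.comp_apply, Finset.mul_sum, ← mul_assoc]
    rw [← Finset.sum_coe_sort, ← s.support.equivFin.symm.sum_comp]
    refine Finset.sum_congr rfl fun p _ => ?_
    rw [← Finset.sum_coe_sort, ← s.support.equivFin.symm.sum_comp]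

theorem posSemidef_of_submatrix_succ {n : ℕ} {M : Matrix (Fin (n + 1)) (Fin (n + 1)) ℂ}
    (hM : M.IsHermitian) (h0 : ∀ j, M 0 j = 0)
    (h : (M.submatrix Fin.succ Fin.succ).PosSemidef) : M.PosSemidef := by
  have h0' (i) : M i 0 = 0 := by rw [← hM.apply, h0, star_zero]
  refine Matrix.PosSemidef.of_dotProduct_mulVec_nonneg hM fun x => ?_
  convert h.dotProduct_mulVec_nonneg (x ∘ Fin.succ) using 1
  simp [dotProduct, Matrix.mulVec, Fin.sum_univ_succ, h0, h0']

theorem posSemidef_of_mul_conj {M : Matrix ι ι ℂ} {a : ι → ℂ} (ha : ∀ i, a i ≠ 0)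
    (h : (Matrix.of fun i j => a i * M i j * conj (a j)).PosSemidef) : M.PosSemidef := by
  refine posSemidef_of_apply_eq
    (h.hadamard (posSemidef_gram fun i => (conj (a i))⁻¹)) fun i j => ?_
  have hi := ha i
  have hj : conj (a j) ≠ 0 := (map_ne_zero _).2 (ha j)
  simp only [Matrix.hadamard_apply, Matrix.of_apply, Matrix.gram_apply, RCLike.inner_apply,
    map_inv₀, Complex.conj_conj]
  field_simp

theorem exists_dotProduct_star_eq [Finite ι] {M : Matrix ι ι ℂ} (hM : M.PosSemidef) :
    ∃ (r : ℕ) (c : ι → Fin r → ℂ), ∀ i j, M i j = c i ⬝ᵥ star (c j) := by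
  obtain ⟨r, v, rfl⟩ := Matrix.posSemidef_iff_eq_sum_vecMulVec.1 hM
  exact ⟨r, fun i l => v l i, fun i j => by
    simp [Matrix.sum_apply, Matrix.vecMulVec_apply, dotProduct]⟩

end PositiveMatrices

universe u

/-- The witness is the reproducing kernel Hilbert space with kernel `B`. -/
theorem exists_gram_eq {X : Type u} {B : Matrix X X ℂ} (hB : B.PosSemidef) :
    ∃ (E : Type u) (_ : NormedAddCommGroup E) (_ : InnerProductSpace ℂ E) (b : X → E),
      Matrix.gram ℂ b = B := by
  let K : Matrix X X (ℂ →L[ℂ] ℂ) := Matrix.of fun x y => B x y • 1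
  have hBstar (x y : X) : conj (B y x) = B x y := hB.1.apply x y
  have hK : K.PosSemidef := by
    have htfae := (RKHS.posSemidef_tfae (K := K)).out 0 2
    refine htfae.mpr ⟨?_, fun v => ?_⟩
    · ext x y
      simpa [K, Matrix.conjTranspose_apply] using hBstar x y
    · have hquad : (v.sum fun x w => v.sum fun x' w' => ⟪K x' x w, w'⟫_ℂ) =
          v.sum fun x w => v.sum fun x' w' => star w * B x x' * w' := by
        refine Finsupp.sum_congr fun x _ => Finsupp.sum_congr fun y _ => ?_
        simp only [K, Matrix.of_apply, ← hBstar x y, RCLike.inner_apply, map_mul, smul_apply,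
          one_apply_eq_self, smul_eq_mul, Complex.star_def]
        ring
      rw [hquad]
      exact (Complex.le_def.1 (hB.2 v)).1
  have : Fact K.PosSemidef := ⟨hK⟩
  refine ⟨RKHS.OfKernel K, inferInstance, inferInstance,
    fun x => RKHS.kerFun (RKHS.OfKernel K) x 1, Matrix.ext fun x y => ?_⟩
  rw [Matrix.gram_apply, RKHS.kerFun_inner, RKHS.kerFun_apply, RKHS.OfKernel.kernel_ofKernel]
  simp [K]

section Operators

variable {E F : Type*} [NormedAddCommGroup E] [InnerProductSpace ℂ E]
  [NormedAddCommGroup F] [InnerProductSpace ℂ F]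

theorem sum_norm_sq_adjoint_apply_le [CompleteSpace E] [CompleteSpace F] {κ : Type*} [Fintype κ]
    {T : κ → E →L[ℂ] F} (hT : ∀ h : κ → E, ‖∑ l, T l (h l)‖ ^ 2 ≤ ∑ l, ‖h l‖ ^ 2) (f : F) :
    ∑ l, ‖((T l)†) f‖ ^ 2 ≤ ‖f‖ ^ 2 := by
  set g : F := ∑ l, T l (((T l)†) f)
  set S : ℝ := ∑ l, ‖((T l)†) f‖ ^ 2
  have hS : (S : ℂ) = ⟪g, f⟫_ℂ := by
    rw [sum_inner, Complex.ofReal_sum]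
    exact Finset.sum_congr rfl fun l _ => by
      rw [ofReal_norm_sq, ContinuousLinearMap.adjoint_inner_right]
  have hgf : S ≤ ‖g‖ * ‖f‖ := by
    rw [← Complex.ofReal_re S, hS]
    exact re_inner_le_norm (𝕜 := ℂ) g f
  have hg : ‖g‖ ^ 2 ≤ S := hT fun l => ((T l)†) f
  nlinarith [sq_nonneg (‖g‖ - ‖f‖)]

theorem inner_sub_apply_ne_zero {C : E →L[ℂ] E} (hC : ‖C‖ < 1) {h : E} (hh : h ≠ 0) :
    ⟪h, h - C h⟫_ℂ ≠ 0 := by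
  intro h0
  rw [inner_sub_right, sub_eq_zero, ← ofReal_norm_sq] at h0
  have hpos : 0 < ‖h‖ := norm_pos_iff.2 hh
  have hlt : ‖C h‖ < ‖h‖ := (C.le_opNorm h).trans_lt (mul_lt_of_lt_one_left hpos hC)
  have hle : ‖h‖ ^ 2 ≤ ‖h‖ * ‖C h‖ := by
    simpa [← h0] using norm_inner_le_norm (𝕜 := ℂ) h (C h)
  nlinarith

theorem posSemidef_gram_sub_gram_comp {ι : Type*} {A : E →L[ℂ] F} (hA : ‖A‖ ≤ 1) (v : ι → E) :
    (Matrix.gram ℂ v - Matrix.gram ℂ (A ∘ v)).PosSemidef := by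
  refine posSemidef_gram_sub_gram_iff.2 fun s => ?_
  have hAs : A (Finsupp.linearCombination ℂ v s) = Finsupp.linearCombination ℂ (A ∘ v) s :=
    Finsupp.apply_linearCombination ℂ A.toLinearMap v s
  rw [← hAs]
  exact (A.le_of_opNorm_le hA _).trans_eq (one_mul _)

end Operators

section Kernel

variable {X : Type*} (H : Type*) [NormedAddCommGroup H] [InnerProductSpace ℂ H] [CompleteSpace H]
  [RKHS ℂ H X ℂ]

/-- The kernel function `k(·, x)` as an element of `H`. -/
def kerVec (x : X) : H := RKHS.kerFun H x 1

/-- The component of the kernel function `k(·, x)` orthogonal to `k(·, y)`. -/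
def kerVecOrth (y x : X) : H := (ℂ ∙ kerVec H y)ᗮ.starProjection (kerVec H x)

/-- The matrix `1 - k(z, y) k(y, w) / (k(z, w) k(y, y))` of McCullough and Quiggin. -/
def pickKer (y : X) : Matrix X X ℂ :=
  Matrix.of fun z w => 1 - ker H z y * ker H y w / (ker H z w * ker H y y)

/-- The kernel has no zeros and `1 - 1 / k` is positive semidefinite; for a normalized kernel this
is the McCullough–Quiggin condition at the normalization point. -/
structure HasPickKernel : Prop where
  ne_zero : ∀ x y : X, ker H x y ≠ 0
  posSemidef : (Matrix.of fun x y : X => 1 - (ker H x y)⁻¹).PosSemidef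

variable {H}

@[simp]
theorem inner_kerVec_left (x : X) (f : H) : ⟪kerVec H x, f⟫_ℂ = f x := by
  simp [kerVec]

@[simp]
theorem inner_kerVec_right (x : X) (f : H) : ⟪f, kerVec H x⟫_ℂ = conj (f x) := by
  rw [← inner_conj_symm, inner_kerVec_left]

theorem kerVec_apply (x y : X) : kerVec H y x = ker H x y := RKHS.kerFun_apply H y 1 x

theorem conj_ker (x y : X) : conj (ker H x y) = ker H y x := by
  rw [← kerVec_apply, ← inner_kerVec_right, inner_kerVec_left, kerVec_apply]

theorem ofReal_norm_kerVec_sq (x : X) : ((‖kerVec H x‖ ^ 2 : ℝ) : ℂ) = ker H x x := by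
  rw [ofReal_norm_sq, inner_kerVec_left, kerVec_apply]

theorem gram_kerVec_apply (x y : X) : Matrix.gram ℂ (kerVec H) x y = ker H x y := by
  rw [Matrix.gram_apply, inner_kerVec_left, kerVec_apply]

theorem ker_eq_one_symm {x₀ : X} (h₀ : ∀ x : X, ker H x x₀ = 1) (x : X) : ker H x₀ x = 1 := by
  rw [← conj_ker, h₀, map_one]

theorem denseRange_linearCombination_kerVec :
    DenseRange (Finsupp.linearCombination ℂ (kerVec H : X → H)) := by
  have hdense : Dense (Submodule.span ℂ (Set.range (kerVec H : X → H)) : Set H) := by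
    rw [Submodule.dense_iff_topologicalClosure_eq_top, Submodule.topologicalClosure_eq_top_iff,
      Submodule.eq_bot_iff]
    refine fun f hf => DFunLike.ext f 0 fun x => ?_
    rw [← inner_kerVec_left, RKHS.coe_zero, Pi.zero_apply]
    exact Submodule.inner_right_of_mem_orthogonal
      (Submodule.subset_span (Set.mem_range_self x)) hf
  rwa [← Finsupp.range_linearCombination, LinearMap.coe_range] at hdense

theorem adjoint_mulOp_kerVec (φ : Mult H) (x : X) :
    ((mulOp H φ)†) (kerVec H x) = conj (φ x) • kerVec H x := by
  refine ext_inner_right ℂ fun f => ?_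
  rw [ContinuousLinearMap.adjoint_inner_left, inner_smul_left, inner_kerVec_left,
    inner_kerVec_left, mulOp_apply, Complex.conj_conj]

theorem kerVecOrth_eq (y x : X) :
    kerVecOrth H y x = kerVec H x - (ker H y x / ker H y y) • kerVec H y := by
  rw [kerVecOrth, Submodule.starProjection_orthogonal_val, Submodule.starProjection_singleton,
    inner_kerVec_left, kerVec_apply, ← ofReal_norm_kerVec_sq y]
  rfl

theorem inner_kerVecOrth (y x x' : X) :
    ⟪kerVecOrth H y x, kerVecOrth H y x'⟫_ℂ =
      ker H x x' - ker H x y * ker H y x' / ker H y y := by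
  have hproj : (ℂ ∙ kerVec H y)ᗮ.starProjection (kerVecOrth H y x') = kerVecOrth H y x' :=
    Submodule.starProjection_eq_self_iff.2 (Submodule.starProjection_apply_mem _ _)
  nth_rw 1 [kerVecOrth]
  rw [Submodule.inner_starProjection_left_eq_right, hproj, kerVecOrth_eq, inner_sub_right,
    inner_smul_right, inner_kerVec_left, inner_kerVec_left, kerVec_apply, kerVec_apply]
  ring

theorem starProjection_adjoint_mulOp_kerVecOrth (φ : Mult H) (y x : X) :
    (ℂ ∙ kerVec H y)ᗮ.starProjection (((mulOp H φ)†) (kerVecOrth H y x)) =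
      conj (φ x) • kerVecOrth H y x := by
  rw [kerVecOrth_eq, map_sub, map_smul, adjoint_mulOp_kerVec, adjoint_mulOp_kerVec, map_sub,
    map_smul, map_smul, map_smul, Submodule.starProjection_orthogonalComplement_singleton_eq_zero,
    smul_zero, smul_zero, sub_zero, ← kerVecOrth_eq, kerVecOrth]

theorem inner_kerVecOrth_eq_mul_pickKer {z w : X} (h : ker H z w ≠ 0) (y : X) :
    ⟪kerVecOrth H y z, kerVecOrth H y w⟫_ℂ = ker H z w * pickKer H y z w := by
  rw [inner_kerVecOrth, pickKer, Matrix.of_apply, mul_sub, mul_one, ← mul_div_assoc,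
    mul_div_mul_left _ _ h]

theorem isHermitian_pickKer (y : X) : (pickKer H y).IsHermitian := by
  ext z w
  simp [pickKer, conj_ker, mul_comm]

end Kernel

section PickProperty

variable {X : Type*} {H : Type*} [NormedAddCommGroup H] [InnerProductSpace ℂ H] [CompleteSpace H]
  [RKHS ℂ H X ℂ]

/-- A row is completed to a square matrix by zero rows. -/
theorem IsCompletePick.exists_row (hpick : IsCompletePick H) {r n : ℕ} (z : Fin n → X)
    (c : Fin n → Fin r → ℂ)
    (hc : (Matrix.of fun i j => ker H (z i) (z j) * (1 - c i ⬝ᵥ star (c j))).PosSemidef) :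
    ∃ φ : Fin r → Mult H,
      (∀ h : Fin r → H, ‖∑ l, mulOp H (φ l) (h l)‖ ^ 2 ≤ ∑ l, ‖h l‖ ^ 2) ∧
      ∀ i l, φ l (z i) = c i l := by
  obtain _ | r := r
  · exact ⟨Fin.elim0, by simp, fun _ l => l.elim0⟩
  let e : Fin (r + 1) → ℂ := Pi.single 0 1
  let W : Fin n → Matrix (Fin (r + 1)) (Fin (r + 1)) ℂ := fun i => Matrix.vecMulVec e (c i)
  have hW (i j) : W i * (W j)ᴴ = (c i ⬝ᵥ star (c j)) • Matrix.diagonal e := by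
    rw [Matrix.conjTranspose_vecMulVec, Matrix.vecMulVec_mul_vecMulVec]
    ext a b
    by_cases ha : a = 0 <;> by_cases hb : b = 0 <;>
      simp [e, ha, hb, Matrix.vecMulVec_apply, Matrix.diagonal_apply, eq_comm]
  have he0 : 0 ≤ e := Pi.single_nonneg.2 zero_le_one
  have he1 : 0 ≤ 1 - e := fun a => by by_cases ha : a = 0 <;> simp [e, ha]
  have hblock := ((hc.submatrix Prod.fst).hadamard
      ((Matrix.PosSemidef.diagonal he0).submatrix Prod.snd)).add
    (((posSemidef_gram (kerVec H ∘ z)).submatrix Prod.fst).hadamard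
      ((Matrix.PosSemidef.diagonal he1).submatrix Prod.snd))
  obtain ⟨Φ, hΦ, hΦW⟩ := hpick (r + 1) n z W <| by
    refine posSemidef_of_apply_eq hblock fun ⟨i, a⟩ ⟨j, b⟩ => ?_
    simp only [Matrix.of_apply, Matrix.sub_apply, hW, Matrix.add_apply, Matrix.hadamard_apply,
      Matrix.submatrix_apply, Matrix.gram_apply, Function.comp_apply, inner_kerVec_left,
      kerVec_apply, ← Matrix.diagonal_one, Matrix.smul_apply, smul_eq_mul, Matrix.diagonal_apply,
      Pi.sub_apply, Pi.one_apply]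
    split_ifs <;> ring
  refine ⟨Φ 0, fun h => le_trans ?_ (hΦ h), fun i l => ?_⟩
  · exact Finset.single_le_sum (f := fun a => ‖∑ l, mulOp H (Φ a l) (h l)‖ ^ 2)
      (fun _ _ => sq_nonneg _) (Finset.mem_univ 0)
  · simp [hΦW, W, e, Matrix.vecMulVec_apply]

/-- The row of multipliers interpolating `c` stays contractive after compression to the complement
of `k(·, y)`, which is invariant under the adjoints of multiplication operators modulo `k(·, y)`. -/
theorem IsCompletePick.posSemidef_inner_kerVecOrth_mul (hpick : IsCompletePick H) {r n : ℕ}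
    (z : Fin n → X) (c : Fin n → Fin r → ℂ)
    (hc : (Matrix.of fun i j => ker H (z i) (z j) * (1 - c i ⬝ᵥ star (c j))).PosSemidef) (y : X) :
    (Matrix.of fun i j =>
      ⟪kerVecOrth H y (z i), kerVecOrth H y (z j)⟫_ℂ * (1 - c i ⬝ᵥ star (c j))).PosSemidef := by
  obtain ⟨φ, hφ, hφc⟩ := hpick.exists_row z c hc
  let f : Fin n → H := fun i => kerVecOrth H y (z i)
  let g : Fin n → PiLp 2 fun _ : Fin r => H := fun i => WithLp.toLp 2 fun l => conj (c i l) • f i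
  let P := (ℂ ∙ kerVec H y)ᗮ.starProjection
  have hg (s : Fin n →₀ ℂ) (l : Fin r) : Finsupp.linearCombination ℂ g s l =
      P (((mulOp H (φ l))†) (Finsupp.linearCombination ℂ f s)) := by
    simp only [P, f, g, Finsupp.linearCombination_apply, Finsupp.sum, map_sum, map_smul,
      starProjection_adjoint_mulOp_kerVecOrth, hφc, WithLp.ofLp_sum, WithLp.ofLp_smul,
      Finset.sum_apply, Pi.smul_apply]
  have hgram : (Matrix.gram ℂ f - Matrix.gram ℂ g).PosSemidef := by
    refine posSemidef_gram_sub_gram_iff.2 fun s => le_of_sq_le_sq ?_ (norm_nonneg _)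
    rw [PiLp.norm_sq_eq_of_L2]
    simp only [hg]
    calc ∑ l, ‖P (((mulOp H (φ l))†) (Finsupp.linearCombination ℂ f s))‖ ^ 2
        ≤ ∑ l, ‖((mulOp H (φ l))†) (Finsupp.linearCombination ℂ f s)‖ ^ 2 := by
          gcongr
          exact Submodule.norm_starProjection_apply_le _ _
      _ ≤ ‖Finsupp.linearCombination ℂ f s‖ ^ 2 := sum_norm_sq_adjoint_apply_le hφ _
  refine posSemidef_of_apply_eq hgram fun i j => ?_
  simp only [f, g, Matrix.of_apply, Matrix.sub_apply, Matrix.gram_apply, PiLp.inner_apply,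
    inner_smul_left, inner_smul_right, Complex.conj_conj, mul_sub, mul_one, dotProduct,
    Finset.mul_sum, Pi.star_apply, Complex.star_def]
  congr 1
  exact Finset.sum_congr rfl fun l _ => by ring

theorem IsCompletePick.ker_ne_zero (hpick : IsCompletePick H) (hnorm : IsNormalized H) (x y : X) :
    ker H x y ≠ 0 := by
  intro hxy
  have hyx : ker H y x = 0 := by rw [← conj_ker, hxy, map_zero]
  obtain ⟨x₀, h₀⟩ := hnorm
  let z : Fin 2 → X := ![x, y]
  let c : Fin 2 → Fin 1 → ℂ := ![fun _ => 1, fun _ => -1]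
  have hc : (Matrix.of fun i j => ker H (z i) (z j) * (1 - c i ⬝ᵥ star (c j))).PosSemidef := by
    refine posSemidef_of_apply_eq Matrix.PosSemidef.zero fun i j => ?_
    fin_cases i <;> fin_cases j <;> simp [z, c, hxy, hyx, dotProduct]
  have hM : (Matrix.of fun i j => ⟪kerVecOrth H x₀ (z i), kerVecOrth H x₀ (z j)⟫_ℂ *
      (1 - c i ⬝ᵥ star (c j))) = !![0, -2; -2, 0] := by
    ext i j
    fin_cases i <;> fin_cases j <;>
      norm_num [z, c, dotProduct, inner_kerVecOrth, hxy, hyx, h₀, ker_eq_one_symm h₀]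
  have hquad := (hM ▸ hpick.posSemidef_inner_kerVecOrth_mul z c hc x₀).dotProduct_mulVec_nonneg
    ![1, 1]
  norm_num [Complex.le_def] at hquad

/-- If `pickKer H x` is the Gram matrix of the rows `c i`, then the Pick matrix of these rows has
rank one, so they can be interpolated. -/
theorem IsCompletePick.posSemidef_pickKer_base_change (hpick : IsCompletePick H)
    (hker : ∀ x y : X, ker H x y ≠ 0) {n : ℕ} {z : Fin n → X} {x : X}
    (hx : ((pickKer H x).submatrix z z).PosSemidef) (y : X) :
    ((pickKer H y).submatrix z z).PosSemidef := by
  obtain ⟨r, c, hc⟩ := exists_dotProduct_star_eq hx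
  let a : Fin n → ℂ := fun i => ker H (z i) x / ‖kerVec H x‖
  have hk : (‖kerVec H x‖ : ℂ) ^ 2 = ker H x x := by
    rw [← ofReal_norm_kerVec_sq, Complex.ofReal_pow]
  have hk0 : (‖kerVec H x‖ : ℂ) ≠ 0 := fun h => hker x x (by rw [← hk, h, zero_pow two_ne_zero])
  have haa (i j) : a i * conj (a j) = ker H (z i) (z j) * (1 - c i ⬝ᵥ star (c j)) := by
    have hzz := hker (z i) (z j)
    simp only [a, ← hc, Matrix.submatrix_apply, pickKer, Matrix.of_apply, ← hk, map_div₀,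
      Complex.conj_ofReal, conj_ker]
    field_simp
    ring
  refine posSemidef_of_mul_conj (fun i => div_ne_zero (hker _ _) hk0 : ∀ i, a i ≠ 0) ?_
  have hrank : (Matrix.of fun i j =>
      ker H (z i) (z j) * (1 - c i ⬝ᵥ star (c j))).PosSemidef :=
    posSemidef_of_apply_eq (Matrix.posSemidef_vecMulVec_self_star a) fun i j => (haa i j).symm
  refine posSemidef_of_apply_eq (hpick.posSemidef_inner_kerVecOrth_mul z c hrank y) fun i j => ?_
  rw [Matrix.of_apply, Matrix.of_apply, mul_right_comm, haa,
    inner_kerVecOrth_eq_mul_pickKer (hker _ _), Matrix.submatrix_apply]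
  ring

theorem IsCompletePick.posSemidef_pickKer_submatrix (hpick : IsCompletePick H)
    (hker : ∀ x y : X, ker H x y ≠ 0) {n : ℕ} (z : Fin n → X) (y : X) :
    ((pickKer H y).submatrix z z).PosSemidef := by
  induction n generalizing y with
  | zero => exact posSemidef_of_apply_eq Matrix.PosSemidef.zero fun i => i.elim0
  | succ n ih =>
    refine hpick.posSemidef_pickKer_base_change hker (x := z 0) ?_ y
    refine posSemidef_of_submatrix_succ ((isHermitian_pickKer _).submatrix z) (fun j => ?_)
      (ih (z ∘ Fin.succ) (z 0))
    rw [Matrix.submatrix_apply, pickKer, Matrix.of_apply, mul_comm (ker H (z 0) (z j)),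
      div_self (mul_ne_zero (hker _ _) (hker _ _)), sub_self]

theorem IsCompletePick.hasPickKernel (hpick : IsCompletePick H) (hnorm : IsNormalized H) :
    HasPickKernel H := by
  have hker := hpick.ker_ne_zero hnorm
  obtain ⟨x₀, h₀⟩ := hnorm
  have hpsd : (pickKer H x₀).PosSemidef :=
    posSemidef_of_submatrix_fin fun _ z => hpick.posSemidef_pickKer_submatrix hker z x₀
  refine ⟨hker, posSemidef_of_apply_eq hpsd fun x y => ?_⟩
  simp [pickKer, h₀, ker_eq_one_symm h₀]

theorem exists_contraction_apply_eq_inner {T : Type*} [NormedAddCommGroup T]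
    [InnerProductSpace ℂ T] {v : X → T}
    (hv : (Matrix.gram ℂ (kerVec H) - Matrix.gram ℂ v).PosSemidef) :
    ∃ A : T →L[ℂ] H, ‖A‖ ≤ 1 ∧ ∀ t x, A t x = ⟪v x, t⟫_ℂ := by
  let J : T →ₗᵢ[ℂ] UniformSpace.Completion T := UniformSpace.Completion.toComplₗᵢ
  let e := Finsupp.linearCombination ℂ (kerVec H : X → H)
  let l := Finsupp.linearCombination ℂ fun x => J (v x)
  have hle (s : X →₀ ℂ) : ‖l s‖ ≤ 1 * ‖e s‖ := by
    have hl : J (Finsupp.linearCombination ℂ v s) = l s :=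
      Finsupp.apply_linearCombination ℂ J.toLinearMap v s
    rw [one_mul, ← hl, J.norm_map]
    exact posSemidef_gram_sub_gram_iff.1 hv s
  have hdense : DenseRange e := denseRange_linearCombination_kerVec
  let B : H →L[ℂ] UniformSpace.Completion T := l.extendOfNorm e
  have hB (x : X) : B (kerVec H x) = J (v x) := by
    simpa [e, l] using LinearMap.extendOfNorm_eq hdense ⟨1, hle⟩ (Finsupp.single x 1)
  refine ⟨B† ∘L J.toContinuousLinearMap, ?_, fun t x => ?_⟩
  · refine ContinuousLinearMap.opNorm_le_bound _ zero_le_one fun t => ?_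
    refine ((B†).le_opNorm (J t)).trans ?_
    rw [LinearIsometryEquiv.norm_map, J.norm_map]
    gcongr
    exact LinearMap.opNorm_extendOfNorm_le hdense zero_le_one hle
  · rw [← inner_kerVec_left, ContinuousLinearMap.comp_apply,
      ContinuousLinearMap.adjoint_inner_right, hB]
    exact J.inner_map_map _ _

theorem mem_multiplierAlgebra_of_posSemidef {θ : X → ℂ}
    (hθ : (Matrix.of fun z w => ker H z w * (1 - θ z * conj (θ w))).PosSemidef) :
    θ ∈ multiplierAlgebra H := by
  obtain ⟨A, -, hA⟩ := exists_contraction_apply_eq_inner (H := H)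
    (v := fun x => conj (θ x) • kerVec H x) <| by
      refine posSemidef_of_apply_eq hθ fun z w => ?_
      rw [Matrix.sub_apply, gram_kerVec_apply, Matrix.gram_apply, inner_smul_left,
        inner_smul_right, inner_kerVec_left, kerVec_apply, Complex.conj_conj, Matrix.of_apply]
      ring
  refine fun f => ⟨A f, funext fun x => ?_⟩
  rw [hA, inner_smul_left, inner_kerVec_left, Complex.conj_conj, Pi.mul_apply]

end PickProperty

section PickKernel

variable {X : Type u} {H : Type*} [NormedAddCommGroup H] [InnerProductSpace ℂ H] [CompleteSpace H]
  [RKHS ℂ H X ℂ]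

/-- If `b` is a feature map of `1 - 1 / k`, then the row of multipliers with values `⟨b x, ·⟩` is
contractive because `k (1 - ⟨b x, b y⟩) = 1` is positive semidefinite. -/
theorem HasPickKernel.exists_contraction (hP : HasPickKernel H) :
    ∃ (E : Type u) (_ : NormedAddCommGroup E) (_ : InnerProductSpace ℂ E) (b : X → E)
      (A : E ⊗[ℂ] H →L[ℂ] H), ‖A‖ ≤ 1 ∧ (∀ x y, ⟪b x, b y⟫_ℂ = 1 - (ker H x y)⁻¹) ∧
        ∀ y f x, A (b y ⊗ₜ f) x = (1 - (ker H x y)⁻¹) * f x := by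
  obtain ⟨E, _, _, b, hgram⟩ := exists_gram_eq hP.posSemidef
  have hb (x y : X) : ⟪b x, b y⟫_ℂ = 1 - (ker H x y)⁻¹ := congrFun₂ hgram x y
  obtain ⟨A, hA1, hA⟩ := exists_contraction_apply_eq_inner (H := H)
    (v := fun x => b x ⊗ₜ[ℂ] kerVec H x) <| by
      refine posSemidef_of_apply_eq (posSemidef_gram fun _ => (1 : ℂ)) fun z w => ?_
      rw [Matrix.sub_apply, gram_kerVec_apply, Matrix.gram_apply, TensorProduct.inner_tmul, hb,
        inner_kerVec_left, kerVec_apply, Matrix.gram_apply, RCLike.inner_apply, map_one, mul_one,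
        sub_mul, one_mul, inv_mul_cancel₀ (hP.ne_zero z w), sub_sub_cancel]
  refine ⟨E, _, _, b, A, hA1, hb, fun y f x => ?_⟩
  rw [hA, TensorProduct.inner_tmul, hb, inner_kerVec_left]

theorem HasPickKernel.one_sub_inv_ker_mem (hP : HasPickKernel H) (w : X) :
    (fun x => 1 - (ker H x w)⁻¹) ∈ multiplierAlgebra H := by
  obtain ⟨E, _, _, b, A, -, -, hA⟩ := hP.exists_contraction
  exact fun f => ⟨A (b w ⊗ₜ f), funext fun x => hA w f x⟩

/-- The multiplier `1 - 1 / k(·, w)`. -/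
def HasPickKernel.oneSubInvKer (hP : HasPickKernel H) (w : X) : Mult H :=
  ⟨fun x => 1 - (ker H x w)⁻¹, hP.one_sub_inv_ker_mem w⟩

theorem HasPickKernel.oneSubInvKer_apply (hP : HasPickKernel H) (w x : X) :
    hP.oneSubInvKer w x = 1 - (ker H x w)⁻¹ := rfl

theorem HasPickKernel.posSemidef_sub_gram_oneSubInvKer (hP : HasPickKernel H) (y : X → H) :
    (Matrix.of fun z w => (1 - (ker H z w)⁻¹) * ⟪y z, y w⟫_ℂ -
      ⟪mulOp H (hP.oneSubInvKer z) (y z), mulOp H (hP.oneSubInvKer w) (y w)⟫_ℂ).PosSemidef := by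
  obtain ⟨E, _, _, b, A, hA1, hb, hA⟩ := hP.exists_contraction
  have hAb (w : X) : A (b w ⊗ₜ y w) = mulOp H (hP.oneSubInvKer w) (y w) :=
    DFunLike.ext _ _ fun x => by rw [hA, mulOp_apply, hP.oneSubInvKer_apply]
  have hgram := posSemidef_gram_sub_gram_comp hA1 fun w => b w ⊗ₜ[ℂ] y w
  refine posSemidef_of_apply_eq hgram fun z w => ?_
  rw [Matrix.of_apply, Matrix.sub_apply, Matrix.gram_apply, Matrix.gram_apply,
    TensorProduct.inner_tmul, hb, Function.comp_apply, Function.comp_apply, hAb, hAb]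

theorem HasPickKernel.norm_mulOp_oneSubInvKer_lt_one (hP : HasPickKernel H) (w : X) :
    ‖mulOp H (hP.oneSubInvKer w)‖ < 1 := by
  obtain ⟨E, _, _, b, A, hA1, hb, hA⟩ := hP.exists_contraction
  have hAb (f : H) : A (b w ⊗ₜ f) = mulOp H (hP.oneSubInvKer w) f :=
    DFunLike.ext _ _ fun x => by rw [hA, mulOp_apply, hP.oneSubInvKer_apply]
  have hw : 0 < ‖kerVec H w‖ ^ 2 := by
    refine (sq_nonneg _).lt_of_ne' fun h => hP.ne_zero w w ?_
    rw [← ofReal_norm_kerVec_sq, h, Complex.ofReal_zero]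
  have hbw : ‖b w‖ ^ 2 = 1 - (‖kerVec H w‖ ^ 2)⁻¹ := by
    rw [← Complex.ofReal_inj, ofReal_norm_sq, hb, ← ofReal_norm_kerVec_sq, Complex.ofReal_sub,
      Complex.ofReal_inv, Complex.ofReal_one]
  have hb1 : ‖b w‖ < 1 := by
    rw [← sq_lt_one_iff₀ (norm_nonneg _), hbw]
    exact sub_lt_self 1 (inv_pos.2 hw)
  refine (ContinuousLinearMap.opNorm_le_bound _ (norm_nonneg _) fun f => ?_).trans_lt hb1
  rw [← hAb, ← TensorProduct.norm_tmul (𝕜 := ℂ)]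
  exact (A.le_of_opNorm_le hA1 _).trans_eq (one_mul _)

theorem HasPickKernel.ker_mem_multiplierAlgebra (hP : HasPickKernel H) (w : X) :
    (fun x => ker H x w) ∈ multiplierAlgebra H := by
  let C := mulOp H (hP.oneSubInvKer w)
  let U := Units.oneSub C (hP.norm_mulOp_oneSubInvKer_lt_one w)
  intro f
  set g : H := (↑U⁻¹ : H →L[ℂ] H) f
  have hg : g - C g = f := DFunLike.congr_fun U.mul_inv f
  refine ⟨g, funext fun x => ?_⟩
  have hk := hP.ne_zero x w
  rw [Pi.mul_apply, ← hg, RKHS.coe_sub, Pi.sub_apply, mulOp_apply, hP.oneSubInvKer_apply]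
  field_simp
  ring

/-- The multiplier `k(·, w)`. -/
def HasPickKernel.kerMult (hP : HasPickKernel H) (w : X) : Mult H :=
  ⟨fun x => ker H x w, hP.ker_mem_multiplierAlgebra w⟩

theorem HasPickKernel.kerMult_apply (hP : HasPickKernel H) (w x : X) :
    hP.kerMult w x = ker H x w := rfl

theorem HasPickKernel.mulOp_oneSubInvKer_kerMult (hP : HasPickKernel H) (w : X) (f : H) :
    mulOp H (hP.oneSubInvKer w) (mulOp H (hP.kerMult w) f) = mulOp H (hP.kerMult w) f - f := by
  refine DFunLike.ext _ _ fun x => ?_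
  have hk := hP.ne_zero x w
  rw [RKHS.coe_sub, Pi.sub_apply, mulOp_apply, mulOp_apply, hP.oneSubInvKer_apply,
    hP.kerMult_apply]
  field_simp

/-- The function `z ↦ ⟨k(·, z) f, f⟩`, whose reciprocal serves as a denominator when `f` is written
as a quotient of multipliers. -/
def HasPickKernel.kerForm (hP : HasPickKernel H) (f : H) (z : X) : ℂ :=
  ⟪mulOp H (hP.kerMult z) f, f⟫_ℂ

theorem HasPickKernel.conj_kerForm (hP : HasPickKernel H) (f : H) (z : X) :
    conj (hP.kerForm f z) = ⟪f, mulOp H (hP.kerMult z) f⟫_ℂ :=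
  inner_conj_symm _ _

theorem HasPickKernel.kerForm_ne_zero (hP : HasPickKernel H) {f : H} (hf : f ≠ 0) (z : X) :
    hP.kerForm f z ≠ 0 := by
  set g := mulOp H (hP.kerMult z) f with hg
  have hfg : g - mulOp H (hP.oneSubInvKer z) g = f := by
    rw [hg, hP.mulOp_oneSubInvKer_kerMult, sub_sub_cancel]
  have hg0 : g ≠ 0 := fun h => hf (by rw [← hfg, h, map_zero, sub_zero])
  have hgf := inner_sub_apply_ne_zero (hP.norm_mulOp_oneSubInvKer_lt_one z) hg0
  rwa [hfg] at hgf

/-- With `y w = k(·, w) g w` the hypothesis reads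
`1 - θ z conj (θ w) = ⟨y z, y w⟩ - ⟨(1 - 1 / k(·, z)) y z, (1 - 1 / k(·, w)) y w⟩`. -/
theorem HasPickKernel.mem_multiplierAlgebra_of_inner (hP : HasPickKernel H) {θ : X → ℂ} (g : X → H)
    (hθ : ∀ z w, 1 - θ z * conj (θ w) =
      ⟪mulOp H (hP.kerMult z) (g z), g w⟫_ℂ + ⟪g z, mulOp H (hP.kerMult w) (g w)⟫_ℂ -
        ⟪g z, g w⟫_ℂ) :
    θ ∈ multiplierAlgebra H := by
  refine mem_multiplierAlgebra_of_posSemidef ?_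
  let y : X → H := fun w => mulOp H (hP.kerMult w) (g w)
  refine posSemidef_of_apply_eq ((posSemidef_gram y).add
    ((posSemidef_gram (kerVec H)).hadamard (hP.posSemidef_sub_gram_oneSubInvKer y))) fun z w => ?_
  simp only [y, Matrix.of_apply, hθ, Matrix.add_apply, Matrix.hadamard_apply, Matrix.gram_apply,
    inner_kerVec_left, kerVec_apply, hP.mulOp_oneSubInvKer_kerMult, inner_sub_left,
    inner_sub_right]
  have hk := hP.ne_zero z w
  field_simp
  ring

theorem HasPickKernel.inv_kerForm_mem (hP : HasPickKernel H) {f : H} (hf : ‖f‖ = 1) :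
    (hP.kerForm f)⁻¹ ∈ multiplierAlgebra H := by
  have hff : ⟪f, f⟫_ℂ = 1 := by rw [← ofReal_norm_sq, hf, one_pow, Complex.ofReal_one]
  have hu : ∀ z, hP.kerForm f z ≠ 0 := hP.kerForm_ne_zero (norm_ne_zero_iff.1 (by simp [hf]))
  have hmem : 1 - (hP.kerForm f)⁻¹ ∈ multiplierAlgebra H := by
    refine hP.mem_multiplierAlgebra_of_inner (fun w => (conj (hP.kerForm f w))⁻¹ • f) fun z w => ?_
    simp only [map_smul, inner_smul_left, inner_smul_right, map_inv₀, Complex.conj_conj, hff,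
      ← hP.conj_kerForm, ← HasPickKernel.kerForm.eq_def, Pi.sub_apply, Pi.one_apply, Pi.inv_apply,
      map_sub, map_one]
    have hz := hu z
    have hw : conj (hP.kerForm f w) ≠ 0 := (map_ne_zero _).2 (hu w)
    field_simp
    ring
  simpa using sub_mem (one_mem _) hmem

theorem HasPickKernel.mul_inv_kerForm_mem (hP : HasPickKernel H) {x₀ : X}
    (h₀ : ∀ x : X, ker H x x₀ = 1) {f : H} (hf : ‖f‖ = 1) :
    (f : X → ℂ) * (hP.kerForm f)⁻¹ ∈ multiplierAlgebra H := by
  have hff : ⟪f, f⟫_ℂ = 1 := by rw [← ofReal_norm_sq, hf, one_pow, Complex.ofReal_one]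
  have hu : ∀ z, hP.kerForm f z ≠ 0 := hP.kerForm_ne_zero (norm_ne_zero_iff.1 (by simp [hf]))
  set φ : X → ℂ := (f : X → ℂ) * (hP.kerForm f)⁻¹
  have hφu (z : X) : φ z * hP.kerForm f z = f z := inv_mul_cancel_right₀ (hu z) _
  have hφu_conj (z : X) : conj (φ z) * conj (hP.kerForm f z) = conj (f z) := by
    rw [← map_mul, hφu]
  -- `kerVec H x₀` is the constant function `1`.
  have hone (w : X) : mulOp H (hP.kerMult w) (kerVec H x₀) = kerVec H w :=
    DFunLike.ext _ _ fun x => by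
      rw [mulOp_apply, kerVec_apply, kerVec_apply, h₀, mul_one, hP.kerMult_apply]
  refine hP.mem_multiplierAlgebra_of_inner (fun w => kerVec H x₀ - conj (φ w) • f) fun z w => ?_
  simp only [map_sub, map_smul, hone, inner_sub_left, inner_sub_right, inner_smul_left,
    inner_smul_right, Complex.conj_conj, inner_kerVec_left, inner_kerVec_right, kerVec_apply,
    mulOp_apply, hP.kerMult_apply, ← hP.conj_kerForm, ← HasPickKernel.kerForm.eq_def, hff, h₀,
    ker_eq_one_symm h₀, one_mul, map_one]
  linear_combination -conj (φ w) * hφu z - φ z * hφu_conj w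

theorem HasPickKernel.exists_multiplier_quotient (hP : HasPickKernel H) (hnorm : IsNormalized H)
    (f : H) :
    ∃ η ∈ multiplierAlgebra H, (∀ x, η x ≠ 0) ∧ (f : X → ℂ) * η ∈ multiplierAlgebra H := by
  obtain rfl | hf := eq_or_ne f 0
  · exact ⟨1, one_mem _, fun _ => one_ne_zero, by rw [RKHS.coe_zero, zero_mul]; exact zero_mem _⟩
  obtain ⟨x₀, h₀⟩ := hnorm
  have hg : ‖(‖f‖ : ℂ)⁻¹ • f‖ = 1 := norm_smul_inv_norm hf
  have hg0 : (‖f‖ : ℂ)⁻¹ • f ≠ 0 := norm_ne_zero_iff.1 (by simp [hg])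
  refine ⟨_, hP.inv_kerForm_mem hg, fun x => inv_ne_zero (hP.kerForm_ne_zero hg0 x), ?_⟩
  have hmem := (multiplierAlgebra H).smul_mem (hP.mul_inv_kerForm_mem h₀ hg) (‖f‖ : ℂ)
  have hf' : (‖f‖ : ℂ) ≠ 0 := Complex.ofReal_ne_zero.2 (norm_ne_zero_iff.2 hf)
  rwa [RKHS.coe_smul, smul_mul_assoc, smul_inv_smul₀ hf'] at hmem

theorem HasPickKernel.coe_mem_multiplierAlgebra (hP : HasPickKernel H) (hnorm : IsNormalized H)
    (h : ∀ φ ∈ multiplierAlgebra H, (∀ x : X, φ x ≠ 0) →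
      (fun x => 1 / φ x) ∈ multiplierAlgebra H) (f : H) : (f : X → ℂ) ∈ multiplierAlgebra H := by
  obtain ⟨η, hη, hη0, hfη⟩ := hP.exists_multiplier_quotient hnorm f
  have hquot : (f : X → ℂ) * η * (fun x => 1 / η x) = f := funext fun x => by
    rw [Pi.mul_apply, Pi.mul_apply, mul_assoc, mul_one_div_cancel (hη0 x), mul_one]
  exact hquot ▸ mul_mem hfη (h η hη hη0)

end PickKernel

theorem exists_character_apply_eq_zero {A : Type*} [SeminormedCommRing A] [NormedAlgebra ℂ A]
    [CompleteSpace A] [T0Space A] {a : A} (ha : ¬ IsUnit a) :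
    ∃ χ : WeakDual.characterSpace ℂ A, χ a = 0 :=
  let _ : NormedCommRing A :=
    { ‹SeminormedCommRing A› with __ := MetricSpace.ofT0PseudoMetricSpace A }
  WeakDual.CharacterSpace.exists_apply_eq_zero ha

section Characters

variable {X : Type*} {H : Type*} [NormedAddCommGroup H] [InnerProductSpace ℂ H] [RKHS ℂ H X ℂ]

theorem continuous_clm_apply_eval (f : H) (x : X) : Continuous fun T : H →L[ℂ] H => T f x :=
  (RKHS.continuous_eval x).comp (by fun_prop)

theorem one_div_mem_multiplierAlgebra {φ : Mult H} (hφ : IsUnit φ) :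
    (fun x => 1 / φ x) ∈ multiplierAlgebra H := by
  obtain ⟨ψ, hψ⟩ := hφ.exists_right_inv
  have hinv : (fun x => 1 / φ x) = ψ := funext fun x => by
    have hx : φ x * ψ x = 1 := DFunLike.congr_fun hψ x
    rw [one_div, inv_eq_of_mul_eq_one_right hx]
  exact hinv ▸ ψ.2

variable [CompleteSpace H]

theorem IsNormalized.exists_eq_one (hnorm : IsNormalized H) : ∃ e : H, ∀ x : X, e x = 1 := by
  obtain ⟨x₀, h₀⟩ := hnorm
  exact ⟨kerVec H x₀, fun x => by rw [kerVec_apply, h₀]⟩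

theorem isUniformInducing_mulOp : IsUniformInducing (mulOp H : Mult H → H →L[ℂ] H) := ⟨rfl⟩

/-- The inclusion of `H` into `Mult(H)` if every function in `H` is a multiplier. -/
def toMult (h : ∀ f : H, (f : X → ℂ) ∈ multiplierAlgebra H) : H →ₗ[ℂ] Mult H where
  toFun f := ⟨f, h f⟩
  map_add' f g := Subtype.ext (RKHS.coe_add f g)
  map_smul' c f := Subtype.ext (RKHS.coe_smul f c)

theorem continuous_toMult (h : ∀ f : H, (f : X → ℂ) ∈ multiplierAlgebra H) :
    Continuous (toMult h) := by
  let M : H →ₗ[ℂ] (H →L[ℂ] H) := (mulOp H).toLinearMap ∘ₗ toMult h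
  have hM (f g : H) (x : X) : M f g x = f x * g x := mulOp_apply _ g x
  refine isUniformInducing_mulOp.isInducing.continuous_iff.2 (?_ : Continuous M)
  refine LinearMap.continuous_of_seq_closed_graph _ fun u f T hu hMu => ?_
  ext g x
  have hT := ((continuous_clm_apply_eval g x).tendsto T).comp hMu
  have hf := (((RKHS.continuous_eval (H := H) x).tendsto f).comp hu).mul_const (g x)
  rw [hM]
  exact tendsto_nhds_unique hT (hf.congr fun n => (hM (u n) g x).symm)

theorem coronaTheorem_of_surjective {E : X → MaxIdealSpace H} (hE : Function.Surjective E)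
    (hEφ : ∀ (x : X) (φ : Mult H), E x φ = φ x) : CoronaTheorem H := by
  intro χ
  obtain ⟨x, rfl⟩ := hE χ
  exact subset_closure ⟨x, hEφ x⟩

theorem CoronaTheorem.le_norm_apply (h : CoronaTheorem H) {φ : Mult H} {c : ℝ}
    (hφ : ∀ x : X, c ≤ ‖φ x‖) (χ : MaxIdealSpace H) : c ≤ ‖χ φ‖ := by
  have hclosed : IsClosed {χ : MaxIdealSpace H | c ≤ ‖χ φ‖} :=
    isClosed_le continuous_const
      ((WeakDual.eval_continuous φ).comp continuous_subtype_val).norm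
  refine closure_minimal ?_ hclosed (h χ)
  rintro χ' ⟨x, hx⟩
  rw [Set.mem_ofPred_eq, hx]
  exact hφ x

variable {e : H} (he : ∀ x, e x = 1)

include he

theorem mulOp_apply_of_eq_one (φ : Mult H) (x : X) : mulOp H φ e x = φ x := by
  rw [mulOp_apply, he, mul_one]

theorem toSubmodule_multiplierAlgebra_eq_range_iff :
    Subalgebra.toSubmodule (multiplierAlgebra H) =
        LinearMap.range (RKHS.coeCLM ℂ : H →L[ℂ] (X → ℂ)).toLinearMap ↔
      ∀ f : H, (f : X → ℂ) ∈ multiplierAlgebra H := by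
  have hle : Subalgebra.toSubmodule (multiplierAlgebra H) ≤
      LinearMap.range (RKHS.coeCLM ℂ : H →L[ℂ] (X → ℂ)).toLinearMap := fun φ hφ =>
    ⟨mulOp H ⟨φ, hφ⟩ e, funext fun x => mulOp_apply_of_eq_one he ⟨φ, hφ⟩ x⟩
  refine ⟨fun h f => h.ge ⟨f, rfl⟩, fun h => le_antisymm hle ?_⟩
  rintro _ ⟨f, rfl⟩
  exact h f

theorem continuous_mult [TopologicalSpace X] (hcont : ∀ f : H, Continuous (f : X → ℂ))
    (φ : Mult H) : Continuous φ :=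
  (hcont (mulOp H φ e)).congr (mulOp_apply_of_eq_one he φ)

theorem mulOp_injective : Function.Injective (mulOp H : Mult H → H →L[ℂ] H) := fun φ ψ h =>
  DFunLike.ext _ _ fun x => by
    rw [← mulOp_apply_of_eq_one he, h, mulOp_apply_of_eq_one he]

theorem t0Space_mult : T0Space (Mult H) :=
  t0Space_of_injective_of_continuous (mulOp_injective he)
    isUniformInducing_mulOp.isInducing.continuous

theorem range_mulOp :
    Set.range (mulOp H) = {T : H →L[ℂ] H | ∀ (f : H) (x : X), T f x = T e x * f x} := by
  ext T
  refine ⟨?_, fun hT => ⟨⟨T e, fun f => ⟨T f, funext (hT f)⟩⟩, ?_⟩⟩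
  · rintro ⟨φ, rfl⟩ f x
    rw [mulOp_apply_of_eq_one he, mulOp_apply]
  · ext f x
    exact (mulOp_apply _ f x).trans (hT f x).symm

theorem completeSpace_mult : CompleteSpace (Mult H) := by
  rw [completeSpace_iff_isComplete_range isUniformInducing_mulOp, range_mulOp he]
  simp only [Set.ofPred_forall]
  exact (isClosed_iInter fun f => isClosed_iInter fun x => isClosed_eq
    (continuous_clm_apply_eval f x)
    ((continuous_clm_apply_eval e x).mul continuous_const)).isComplete

/-- Evaluation at a point as a character of the multiplier algebra. -/
def evalCharacter (x : X) : MaxIdealSpace H :=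
  ⟨StrongDual.toWeakDual
    { toFun := fun φ : Mult H => φ x
      map_add' := fun _ _ => rfl
      map_smul' := fun _ _ => rfl
      cont := by
        simp only [← mulOp_apply_of_eq_one he]
        exact (continuous_clm_apply_eval e x).comp isUniformInducing_mulOp.isInducing.continuous },
    fun h => one_ne_zero (α := ℂ) (DFunLike.congr_fun h (1 : Mult H)), fun _ _ => rfl⟩

theorem evalCharacter_apply (x : X) (φ : Mult H) : evalCharacter he x φ = φ x := rfl

theorem continuous_evalCharacter [TopologicalSpace X] (hcont : ∀ f : H, Continuous (f : X → ℂ)) :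
    Continuous (evalCharacter he : X → MaxIdealSpace H) :=
  Continuous.subtype_mk (WeakDual.continuous_of_continuous_eval (continuous_mult he hcont)) _

theorem evalCharacter_surjective (hmax : IsMaximalDomain H)
    (hmem : ∀ f : H, (f : X → ℂ) ∈ multiplierAlgebra H) :
    Function.Surjective (evalCharacter he : X → MaxIdealSpace H) := by
  intro χ
  let ρ : H →L[ℂ] ℂ := (WeakDual.CharacterSpace.toCLM χ).comp ⟨toMult hmem, continuous_toMult hmem⟩
  have hρ (f : H) : ρ f = χ (toMult hmem f) := rfl
  have hρ_mult : IsPartiallyMultiplicative H ρ := by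
    refine ⟨fun h0 => one_ne_zero (α := ℂ) ?_, fun f g h hfg => ?_⟩
    · have h1 : toMult hmem e = 1 := DFunLike.ext _ _ he
      rw [← map_one χ, ← h1, ← hρ, h0, zero_apply]
    · have hmul : toMult hmem h = toMult hmem f * toMult hmem g :=
        DFunLike.ext _ _ (congrFun hfg)
      rw [hρ, hρ, hρ, hmul, map_mul]
  obtain ⟨x, hx⟩ := hmax ρ hρ_mult
  refine ⟨x, DFunLike.ext _ _ fun φ => ?_⟩
  have hφ : toMult hmem (mulOp H φ e) = φ := DFunLike.ext _ _ (mulOp_apply_of_eq_one he φ)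
  rw [evalCharacter_apply, ← mulOp_apply_of_eq_one he, ← hx, hρ, hφ]

theorem exists_homeomorph_maxIdealSpace [TopologicalSpace X] [CompactSpace X]
    (hcont : ∀ f : H, Continuous (f : X → ℂ)) (hsep : ∀ x y : X, x ≠ y → ∃ f : H, f x ≠ f y)
    (hmax : IsMaximalDomain H) (hmem : ∀ f : H, (f : X → ℂ) ∈ multiplierAlgebra H) :
    ∃ E : X ≃ₜ MaxIdealSpace H, ∀ (x : X) (φ : Mult H), E x φ = φ x := by
  have hinj : Function.Injective (evalCharacter he : X → MaxIdealSpace H) := by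
    intro x y hxy
    by_contra hne
    obtain ⟨f, hf⟩ := hsep x y hne
    exact hf (DFunLike.congr_fun hxy (toMult hmem f))
  let E := Equiv.ofBijective _ ⟨hinj, evalCharacter_surjective he hmax hmem⟩
  exact ⟨Continuous.homeoOfEquivCompactToT2 (f := E) (continuous_evalCharacter he hcont),
    evalCharacter_apply he⟩

theorem CoronaTheorem.oneFunctionCoronaTheorem (h : CoronaTheorem H) :
    OneFunctionCoronaTheorem H := by
  rintro φ hφ ⟨c, hc, hcφ⟩
  have := completeSpace_mult he
  have := t0Space_mult he
  let φ' : Mult H := ⟨φ, hφ⟩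
  refine one_div_mem_multiplierAlgebra (φ := φ') (by_contra fun hu => ?_)
  obtain ⟨χ, hχ⟩ := exists_character_apply_eq_zero hu
  have hcχ : c ≤ ‖χ φ'‖ := h.le_norm_apply hcφ χ
  rw [hχ, norm_zero] at hcχ
  exact hc.not_ge hcχ

theorem OneFunctionCoronaTheorem.one_div_mem [TopologicalSpace X] [CompactSpace X]
    (h : OneFunctionCoronaTheorem H) (hcont : ∀ f : H, Continuous (f : X → ℂ)) {φ : X → ℂ}
    (hφ : φ ∈ multiplierAlgebra H) (h0 : ∀ x, φ x ≠ 0) :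
    (fun x => 1 / φ x) ∈ multiplierAlgebra H := by
  have hφc : Continuous φ := continuous_mult he hcont ⟨φ, hφ⟩
  obtain ⟨c, hc, hcφ⟩ := isCompact_univ.exists_forall_le' hφc.norm.continuousOn
    fun x _ => norm_pos_iff.2 (h0 x)
  exact h φ hφ ⟨c, hc, fun x => hcφ x (Set.mem_univ x)⟩

end Characters

end PickSpace

end

theorem proposition1p5 {X : Type*} [TopologicalSpace X] [CompactSpace X]
    (H : Type*) [NormedAddCommGroup H] [InnerProductSpace ℂ H] [CompleteSpace H]
    [RKHS ℂ H X ℂ]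
    (hnorm : PickSpace.IsNormalized H) (hpick : PickSpace.IsCompletePick H)
    (hcont : ∀ f : H, Continuous (f : X → ℂ))
    (hsep : ∀ x y : X, x ≠ y → ∃ f : H, f x ≠ f y)
    (hmax : PickSpace.IsMaximalDomain H) :
    List.TFAE [
      Subalgebra.toSubmodule (PickSpace.multiplierAlgebra H) =
        LinearMap.range (RKHS.coeCLM ℂ : H →L[ℂ] (X → ℂ)).toLinearMap,
      PickSpace.CoronaTheorem H,
      ∃ e : X ≃ₜ PickSpace.MaxIdealSpace H,
        ∀ (x : X) (φ : PickSpace.Mult H), e x φ = φ x,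
      PickSpace.OneFunctionCoronaTheorem H,
      ∀ φ ∈ PickSpace.multiplierAlgebra H, (∀ x : X, φ x ≠ 0) →
        (fun x => 1 / φ x) ∈ PickSpace.multiplierAlgebra H] := by
  obtain ⟨e, he⟩ := hnorm.exists_eq_one
  have hmem_iff := PickSpace.toSubmodule_multiplierAlgebra_eq_range_iff he
  have hP := hpick.hasPickKernel hnorm
  tfae_have 1 → 3 := fun h =>
    PickSpace.exists_homeomorph_maxIdealSpace he hcont hsep hmax (hmem_iff.1 h)
  tfae_have 3 → 2 := fun ⟨E, hE⟩ => PickSpace.coronaTheorem_of_surjective E.surjective hE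
  tfae_have 2 → 4 := fun h => h.oneFunctionCoronaTheorem he
  tfae_have 4 → 5 := fun h φ hφ h0 => h.one_div_mem he hcont hφ h0
  tfae_have 5 → 1 := fun h => hmem_iff.2 (hP.coe_mem_multiplierAlgebra hnorm h)
  tfae_finish
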